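/- Let $q$ be a prime power, $q=p^m$ with $p$ prime and $m\ge 1$, such that $q\equiv 1\pmod 3$. There is exactly one integer $c$ such that $c\equiv 1\pmod 3$, $4q=c^2+27d^2$ for some integer $d$, and, in the case $p\equiv 1\pmod 3$, $p\nmid c$. Write $c=c(q)$ and put $$D(q)=\sqrt{q^2+q+1}\cdot\left[(q+2)^3-3(q+2)^2-3(q-1)(q+2)+(3+c(q))q-1\right]^{(q-1)/6}.$$ Let $\chi$ be any complex character of order $3$ of $\mathbb F_q^\times$, extended by $\chi(0)=0$, let $\omega$ be any primitive complex third root of unity, let $Q_q=(\chi(i-j))_{i,j\in\mathbb F_q}$ be the generalized Paley core, and let $$W_q=\begin{bmatrix}0&\mathbf 1_q^{\intercal}\\ \mathbf 1_q&Q_q\end{bmatrix}.$$ Then $W_q+\omega I_{q+1}$, a matrix of order $q+1\equiv 2\pmod 3$, has all its entries in $\{1,\omega,\omega^2\}$, and $$|\det(W_q+\omega I_{q+1})|=D(q).$$ In particular, for every prime power $q\equiv 1\pmod 3$ there is a matrix $M$ of order $q+1$ with entries in the third roots of unity such that $|\det M|=D(q)$. Moreover, as $q\to\infty$ through the prime powers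 $q\equiv1\pmod 3$, these determinants asymptotically reach the fraction $1/\sqrt2$ of the Barba bound $\sqrt{2n-1}\,(n-1)^{(n-1)/2}$ for order $n=q+1$, that is, $$\lim_{q\to\infty}\frac{D(q)}{\sqrt{2q+1}\;q^{q/2}}=\frac1{\sqrt2}.$$ -/

import Mathlib

open Filter Topology

noncomputable section

/-- The generalized Paley core of a multiplicative character `χ` of a field `F`
(with `χ 0 = 0`): the matrix indexed by `F` with `(i, j)` entry `χ (i - j)`. -/
def paleyCore {F : Type*} [Field F] (χ : MulChar F ℂ) : Matrix F F ℂ :=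
  Matrix.of fun i j => χ (i - j)

/-- The bordered matrix `W = [0, 1ᵀ; 1, Q]` with `Q` the generalized Paley core of `χ`;
its order is `|F| + 1`. -/
def paleyWeighing {F : Type*} [Field F] (χ : MulChar F ℂ) :
    Matrix (Unit ⊕ F) (Unit ⊕ F) ℂ :=
  Matrix.fromBlocks 0 (Matrix.of fun _ _ => 1) (Matrix.of fun _ _ => 1) (paleyCore χ)

/-- All entries of `M` belong to the set `μ₃` of complex third roots of unity. -/
def IsOverThirdRoots {ι : Type*} (M : Matrix ι ι ℂ) : Prop :=
  ∀ i j, M i j ^ 3 = 1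

/-- The normalization of the integer `c` of cubic cyclotomy of order `q`: `c ≡ 1 (mod 3)` and
`4q = c² + 27d²` for some integer `d`, the representation being proper
(the prime `p` dividing `q` does not divide `c`) when `p ≡ 1 (mod 3)`. -/
def IsCubicCyclotomicInt (q : ℕ) (c : ℤ) : Prop :=
  c ≡ 1 [ZMOD 3] ∧ (∃ d : ℤ, 4 * (q : ℤ) = c ^ 2 + 27 * d ^ 2) ∧
    ∀ p : ℕ, p.Prime → p ∣ q → p ≡ 1 [MOD 3] → ¬ (p : ℤ) ∣ c

/-- `√(q²+q+1) · [(q+2)³ - 3(q+2)² - 3(q-1)(q+2) + (3+c)q - 1]^((q-1)/6)`, over the reals. -/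
def paleyDetValue (q : ℕ) (c : ℤ) : ℝ :=
  √((q : ℝ) ^ 2 + q + 1) *
    (((q : ℝ) + 2) ^ 3 - 3 * ((q : ℝ) + 2) ^ 2 - 3 * ((q : ℝ) - 1) * ((q : ℝ) + 2)
      + (3 + (c : ℝ)) * q - 1) ^ (((q : ℝ) - 1) / 6)

/-- The Barba bound `√(2n-1) · (n-1)^((n-1)/2)`, over the reals. -/
def barbaBound (n : ℕ) : ℝ :=
  √(2 * (n : ℝ) - 1) * ((n : ℝ) - 1) ^ (((n : ℝ) - 1) / 2)

end

/-!
Let `G` be the Gauss sum of the cubic character `χ` and `J = J(χ, χ)` its Jacobi sum.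

*Determinant.* The generalized Paley core is a convolution operator on the additive group of `F`,
so the additive characters diagonalize it, with eigenvalues `0` (trivial character) and `χ⁻¹(a) G`
for `a ≠ 0`. The border of the bordered matrix only touches the trivial character. Hence
`det (W + ω I) = (ω² - q) ∏_{a ≠ 0} (χ⁻¹(a) G + ω)` (`det_paleyWeighing_add_smul_one`), and grouping
the factors by the three values of `χ` gives the modulus `√(q² + q + 1) |G³ + 1|^((q - 1) / 3)`
(`prod_units_pow_three`). Since `G³ = q J` and `|J|² = q`, one finds
`|G³ + 1|² = q³ + c q + 1` with `c = J + J̄`, which is the bracket in `paleyDetValue`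
(`norm_det_paleyWeighing_add_smul_one`).

*The integer `c`.* In `ℤ[ω]`, `J ≡ -1` modulo `3`; writing this out gives `c ≡ 1 (mod 3)` and
`4q = c² + 27d²` (`exists_trace_jacobiSum`). The trace `c` is an integral count of values of
`x (1 - x)` by cubic class, and this count can be evaluated in `F` itself by power sums: there
`c = ± choose (2a) a` with `a = (q - 1) / 3` (`intCast_trace_jacobiSum`), which by Lucas's theorem
does not vanish when `p ≡ 1 (mod 3)` (`not_dvd_choose_two_mul`). So the representation is proper.
It is unique (`IsCubicCyclotomicInt.unique`): for `p ≡ 1 (mod 3)` by the classical divisibility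
argument for two proper representations, for `p ≡ 2 (mod 3)` because descent forces `d = 0`.
Thus `c` depends on `q` only, not on `F` or `χ`.

*Asymptotics.* The quotient by the Barba bound is
`√((q² + q + 1) / ((2q + 1) q)) (1 + c / q² + 1 / q³)^((q - 1) / 6)`, and `|c| ≤ 2√q` makes the second
factor tend to `1`.
-/

/-! ### Representations of `4q` by `c² + 27d²` -/

/-- A square root `s` of `-3` gives the element `(s - 1) / 2` of order `3` in `(ZMod p)ˣ`. -/
lemma modEq_one_of_sq_eq_neg_three {p : ℕ} [Fact p.Prime] (h2 : p ≠ 2) (h3 : p ≠ 3)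
    {s : ZMod p} (hs : s ^ 2 = -3) : p ≡ 1 [MOD 3] := by
  have hp : p.Prime := Fact.out
  have h2' : (2 : ZMod p) ≠ 0 := by
    intro h
    have h' : ((2 : ℕ) : ZMod p) = 0 := by exact_mod_cast h
    rw [ZMod.natCast_eq_zero_iff] at h'
    exact h2 ((Nat.prime_dvd_prime_iff_eq hp Nat.prime_two).1 h')
  have h3' : (3 : ZMod p) ≠ 0 := by
    intro h
    have h' : ((3 : ℕ) : ZMod p) = 0 := by exact_mod_cast h
    rw [ZMod.natCast_eq_zero_iff] at h'
    exact h3 ((Nat.prime_dvd_prime_iff_eq hp Nat.prime_three).1 h')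
  set u : ZMod p := (s - 1) / 2 with hu
  have hs' : s = 2 * u + 1 := by rw [hu]; field_simp; ring
  have hq : u ^ 2 + u + 1 = 0 := by
    have : (2 : ZMod p) * 2 * (u ^ 2 + u + 1) = 0 := by rw [hs'] at hs; linear_combination hs
    simpa [h2'] using this
  have hu1 : u ≠ 1 := by
    intro h
    rw [h] at hq
    exact h3' (by linear_combination hq)
  have hu0 : u ≠ 0 := by
    intro h
    rw [h] at hq
    simp at hq
  have hord : orderOf u = 3 :=
    orderOf_eq_prime (by linear_combination (u - 1) * hq) hu1
  have hd : 3 ∣ p - 1 := by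
    rw [← hord]; exact orderOf_dvd_of_pow_eq_one (ZMod.pow_card_sub_one_eq_one hu0)
  exact ((Nat.modEq_iff_dvd' hp.one_lt.le).2 hd).symm

lemma dvd_and_dvd_of_dvd_sq_add {p : ℕ} (hp : p.Prime) (hp3 : p ≡ 2 [MOD 3]) {c d : ℤ} {n : ℕ}
    (h : 4 * (p : ℤ) ^ (n + 2) = c ^ 2 + 27 * d ^ 2) : (p : ℤ) ∣ c ∧ (p : ℤ) ∣ d := by
  rcases eq_or_ne p 2 with rfl | h2
  -- For `p = 2` both coordinates are even: for odd ones `c² + 27d² ≡ 4 (mod 8)`.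
  · have h8 : (8 : ℤ) ∣ c ^ 2 + 27 * d ^ 2 := ⟨2 * 2 ^ n, by rw [← h]; push_cast; ring⟩
    have hc : c % 8 = 0 ∨ c % 8 = 1 ∨ c % 8 = 2 ∨ c % 8 = 3 ∨ c % 8 = 4 ∨ c % 8 = 5 ∨ c % 8 = 6 ∨
      c % 8 = 7 := by omega
    have hd : d % 8 = 0 ∨ d % 8 = 1 ∨ d % 8 = 2 ∨ d % 8 = 3 ∨ d % 8 = 4 ∨ d % 8 = 5 ∨ d % 8 = 6 ∨
      d % 8 = 7 := by omega
    have h8' := Int.emod_eq_zero_of_dvd h8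
    push_cast
    rcases hc with hc | hc | hc | hc | hc | hc | hc | hc <;>
    rcases hd with hd | hd | hd | hd | hd | hd | hd | hd <;>
    first
    | exact ⟨by omega, by omega⟩
    | (exfalso; simp [pow_two, Int.add_emod, Int.mul_emod, hc, hd] at h8')
  · have h3 : p ≠ 3 := by rintro rfl; exact absurd hp3 (by decide)
    have : Fact p.Prime := ⟨hp⟩
    have hz : (c : ZMod p) ^ 2 + 27 * (d : ZMod p) ^ 2 = 0 := by
      have := congrArg (Int.cast : ℤ → ZMod p) h
      push_cast at this
      rw [← this]; simp
    have h3' : (3 : ZMod p) ≠ 0 := by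
      intro h
      have h' : ((3 : ℕ) : ZMod p) = 0 := by exact_mod_cast h
      rw [ZMod.natCast_eq_zero_iff] at h'
      exact h3 ((Nat.prime_dvd_prime_iff_eq hp Nat.prime_three).1 h')
    have hd : (d : ZMod p) = 0 := by
      by_contra hd
      have : (c / (3 * d) : ZMod p) ^ 2 = -3 := by
        field_simp
        linear_combination hz
      have h1 := modEq_one_of_sq_eq_neg_three h2 h3 this
      exact absurd (h1.symm.trans hp3) (by decide)
    have hc : (c : ZMod p) = 0 := by simpa [hd] using hz
    exact ⟨(ZMod.intCast_zmod_eq_zero_iff_dvd _ _).1 hc, (ZMod.intCast_zmod_eq_zero_iff_dvd _ _).1 hd⟩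

/-- Infinite descent: since `-3` is not a square modulo `p`, powers of `p` can be
divided out of both coordinates until `4 = c² + 27d²` is reached. -/
lemma eq_zero_of_four_mul_pow_eq_sq_add {p : ℕ} (hp : p.Prime) (hp3 : p ≡ 2 [MOD 3]) (k : ℕ) :
    ∀ {c d : ℤ}, 4 * (p : ℤ) ^ (2 * k) = c ^ 2 + 27 * d ^ 2 → d = 0 := by
  induction k with
  | zero =>
    intro c d h
    by_contra hd
    have : 0 < d ^ 2 := by positivity
    simp only [mul_zero, pow_zero] at h
    nlinarith [sq_nonneg c]
  | succ k ih =>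
    intro c d h
    obtain ⟨⟨c', rfl⟩, ⟨d', rfl⟩⟩ := dvd_and_dvd_of_dvd_sq_add hp hp3 (n := 2 * k) h
    have hp0 : (p : ℤ) ^ 2 ≠ 0 := pow_ne_zero _ (by exact_mod_cast hp.ne_zero)
    rw [ih (c := c') (d := d') (mul_left_cancel₀ hp0 (by linear_combination h)), mul_zero]

/-- The classical uniqueness of a proper representation of `4q` by `c² + 27d²`: the prime power
`q` divides one of `cd' ± c'd`, which is too small to be a nonzero multiple of `q`. -/
lemma sq_eq_sq_of_proper_representations {p m : ℕ} (hp : p.Prime) (hp2 : p ≠ 2) (hm : 0 < m)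
    {c c' d d' : ℤ}
    (h : 4 * (p : ℤ) ^ m = c ^ 2 + 27 * d ^ 2) (h' : 4 * (p : ℤ) ^ m = c' ^ 2 + 27 * d' ^ 2)
    (hc : ¬ (p : ℤ) ∣ c) (hc' : ¬ (p : ℤ) ∣ c') : c ^ 2 = c' ^ 2 := by
  have hpi : Prime (p : ℤ) := Nat.prime_iff_prime_int.1 hp
  have hq : (0 : ℤ) < (p : ℤ) ^ m := pow_pos (by exact_mod_cast hp.pos) m
  set q : ℤ := (p : ℤ) ^ m with hqdef
  have key : ∀ e : ℤ, 4 * q = c' ^ 2 + 27 * e ^ 2 → q ∣ c * e - c' * d → c ^ 2 = c' ^ 2 := by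
    rintro e he ⟨k, hk⟩
    -- Brahmagupta's identity; as `27 > 16`, it leaves no room for `k ≠ 0`.
    have h1 : 16 * q ^ 2 = (c * c' + 27 * d * e) ^ 2 + 27 * (q * k) ^ 2 := by
      rw [← hk]; linear_combination 4 * q * h + (c ^ 2 + 27 * d ^ 2) * he
    have hk0 : k = 0 := by
      by_contra hk0
      have : 0 < k ^ 2 := by positivity
      nlinarith [sq_nonneg (c * c' + 27 * d * e), sq_pos_of_pos hq]
    have h2 : c * e = c' * d := by rw [hk0] at hk; linarith
    have h3 : 4 * q * (c ^ 2 - c' ^ 2) = 0 := by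
      linear_combination c ^ 2 * he - c' ^ 2 * h + 27 * (c * e + c' * d) * h2
    have h4 : c ^ 2 - c' ^ 2 = 0 := by
      rcases mul_eq_zero.1 h3 with h3 | h3
      · omega
      · exact h3
    linarith
  have hprod : q ∣ (c * d' - c' * d) * (c * d' + c' * d) :=
    ⟨4 * (d' ^ 2 - d ^ 2), by linear_combination d' ^ 2 * (-h) + d ^ 2 * h'⟩
  -- `p` divides only one of the two factors, so all of `q` divides that factor.
  by_cases hdiv : (p : ℤ) ∣ c * d' - c' * d
  · have hnot : ¬ (p : ℤ) ∣ c * d' + c' * d := by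
      intro hdiv'
      have h2c : (p : ℤ) ∣ 2 * c * d' := by
        have := dvd_add hdiv hdiv'
        ring_nf at this ⊢; exact this
      have hp2' : ¬ (p : ℤ) ∣ 2 := by
        intro h
        exact hp2 ((Nat.prime_dvd_prime_iff_eq hp Nat.prime_two).1 (by exact_mod_cast h))
      have hd' : (p : ℤ) ∣ d' := by
        rcases hpi.dvd_or_dvd h2c with h | h
        · rcases hpi.dvd_or_dvd h with h | h
          · exact absurd h hp2'
          · exact absurd h hc
        · exact h
      have hpq : (p : ℤ) ∣ q := dvd_pow_self _ hm.ne'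
      have : (p : ℤ) ∣ c' ^ 2 := by
        have e : c' ^ 2 = 4 * q - 27 * d' ^ 2 := by linarith
        rw [e]
        exact dvd_sub (hpq.mul_left _) ((dvd_pow hd' two_ne_zero).mul_left _)
      exact hc' (hpi.dvd_of_dvd_pow this)
    exact key d' h' (hpi.pow_dvd_of_dvd_mul_right m hnot hprod)
  · have := hpi.pow_dvd_of_dvd_mul_left m hdiv hprod
    refine key (-d') (by linear_combination h') ?_
    have e : c * -d' - c' * d = -(c * d' + c' * d) := by ring
    rw [e]
    exact (dvd_neg).2 this

theorem IsCubicCyclotomicInt.unique {q : ℕ} (hq : IsPrimePow q) (hq3 : q ≡ 1 [MOD 3]) {c c' : ℤ}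
    (h : IsCubicCyclotomicInt q c) (h' : IsCubicCyclotomicInt q c') : c' = c := by
  obtain ⟨p, m, hp, hm, rfl⟩ := hq
  have hp := hp.nat_prime
  obtain ⟨hc, ⟨d, hd⟩, hprop⟩ := h
  obtain ⟨hc', ⟨d', hd'⟩, hprop'⟩ := h'
  push_cast at hd hd'
  suffices hsq : c ^ 2 = c' ^ 2 by
    rcases sq_eq_sq_iff_eq_or_eq_neg.1 hsq with e | e
    · exact e.symm
    · subst e
      exfalso
      have h1 := hc.dvd
      have h2 := hc'.dvd
      omega
  have hcases : p % 3 = 0 ∨ p % 3 = 1 ∨ p % 3 = 2 := by omega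
  rcases hcases with h3 | h3 | h3
  · exfalso
    have : p ^ m % 3 = 0 := Nat.mod_eq_zero_of_dvd (dvd_pow (Nat.dvd_of_mod_eq_zero h3) hm.ne')
    have h1 : p ^ m % 3 = 1 := hq3
    omega
  · refine sq_eq_sq_of_proper_representations hp ?_ ?_ hd hd'
      (hprop p hp (dvd_pow_self _ hm.ne') h3) (hprop' p hp (dvd_pow_self _ hm.ne') h3)
    · rintro rfl
      omega
    · exact hm
  · have heven : Even m := by
      by_contra hodd
      obtain ⟨k, rfl⟩ := Nat.not_even_iff_odd.1 hodd
      have h1 : p ^ (2 * k + 1) ≡ 2 ^ (2 * k + 1) [MOD 3] := Nat.ModEq.pow _ h3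
      have h2 : 2 ^ (2 * k + 1) ≡ 2 [MOD 3] := by
        rw [pow_succ, pow_mul]
        exact ((show 2 ^ 2 ≡ 1 [MOD 3] by decide).pow k).mul_right 2 |>.trans (by simp; rfl)
      exact absurd (hq3.symm.trans (h1.trans h2)) (by decide)
    obtain ⟨k, rfl⟩ := heven
    rw [← two_mul] at hd hd'
    have hp3 : p ≡ 2 [MOD 3] := h3
    have e := eq_zero_of_four_mul_pow_eq_sq_add hp hp3 k hd
    have e' := eq_zero_of_four_mul_pow_eq_sq_add hp hp3 k hd'
    rw [e] at hd
    rw [e'] at hd'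
    linarith

/-- By Lucas's theorem: all base-`p` digits of `a` and `2a` are `(p - 1) / 3` and
`2(p - 1) / 3`, so there are no carries. -/
lemma not_dvd_choose_two_mul {p : ℕ} (hp : p.Prime) (hp3 : p ≡ 1 [MOD 3]) (m : ℕ) :
    ∀ {a : ℕ}, p ^ m = 3 * a + 1 → ¬ p ∣ (2 * a).choose a := by
  have : Fact p.Prime := ⟨hp⟩
  obtain ⟨b, hb⟩ : ∃ b, p = 3 * b + 1 := ⟨p / 3, by have : p % 3 = 1 := hp3; omega⟩
  have hb0 : ¬ p ∣ (2 * b).choose b := fun h => by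
    have h1 := (hp.dvd_factorial).1 (h.trans
      (Dvd.intro (b.factorial * (2 * b - b).factorial)
        (by rw [← mul_assoc]; exact Nat.choose_mul_factorial_mul_factorial (by omega))))
    omega
  induction m with
  | zero =>
    intro a ha
    have : a = 0 := by simpa using ha
    subst this
    simpa using hp.one_lt.ne'
  | succ m ih =>
    intro a ha
    obtain ⟨a', ha'⟩ : ∃ a', p ^ m = 3 * a' + 1 := by
      refine ⟨p ^ m / 3, ?_⟩
      have h1 : p ^ m % 3 = 1 ^ m % 3 := Nat.ModEq.pow m hp3
      rw [one_pow] at h1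
      omega
    have haa : a = b + p * a' := by
      have h2 : p * (3 * a' + 1) = 3 * a + 1 := by rw [← ha', ← ha, pow_succ, mul_comm]
      have h3 : 3 * (p * a') + p = p * (3 * a' + 1) := by ring
      omega
    have haa2 : 2 * a = 2 * b + p * (2 * a') := by rw [haa]; ring
    have hL := Choose.choose_modEq_choose_mod_mul_choose_div_nat (n := 2 * a) (k := a) (p := p)
    rw [haa2] at hL
    nth_rw 1 [haa] at hL
    nth_rw 2 [haa] at hL
    rw [haa] at hL
    rw [Nat.add_mul_mod_self_left, Nat.add_mul_mod_self_left, Nat.add_mul_div_left _ _ hp.pos,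
      Nat.add_mul_div_left _ _ hp.pos, Nat.mod_eq_of_lt (by omega), Nat.mod_eq_of_lt (by omega),
      Nat.div_eq_of_lt (by omega), Nat.div_eq_of_lt (by omega), zero_add, zero_add] at hL
    rw [haa2, haa]
    intro hdvd
    rcases hp.dvd_mul.1 ((hL.dvd_iff dvd_rfl).1 hdvd) with h | h
    · exact hb0 h
    · exact ih ha' h

/-! ### Cubic characters and their Jacobi sums -/

lemma add_sq_of_pow_three_eq_one {R : Type*} [CommRing R] [IsDomain R] {z : R} [Decidable (z = 1)]
    (hz : z ^ 3 = 1) : z + z ^ 2 = ((if z = 1 then 2 else -1 : ℤ) : R) := by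
  split_ifs with h
  · rw [h]; norm_num
  · have h1 : (z - 1) * (z + z ^ 2 + 1) = 0 := by linear_combination hz
    have h2 := (mul_eq_zero.1 h1).resolve_left (sub_ne_zero.2 h)
    push_cast
    linear_combination h2

lemma MulChar.pow_three_eq_one {F : Type*} [Field F] {χ : MulChar F ℂ} (hχ : orderOf χ = 3) :
    χ ^ 3 = 1 :=
  hχ ▸ pow_orderOf_eq_one χ

lemma MulChar.apply_pow_three {F : Type*} [Field F] {χ : MulChar F ℂ} (hχ : orderOf χ = 3) {x : F} (hx : x ≠ 0) :
    χ x ^ 3 = 1 := by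
  rw [← MulChar.pow_apply' χ three_ne_zero, MulChar.pow_three_eq_one hχ,
    MulChar.one_apply hx.isUnit]

lemma MulChar.inv_apply_eq_sq {F : Type*} [Field F] {χ : MulChar F ℂ} (hχ : orderOf χ = 3) (x : F) :
    χ⁻¹ x = χ x ^ 2 := by
  have : χ⁻¹ = χ ^ 2 := by
    rw [inv_eq_iff_mul_eq_one, ← pow_succ', MulChar.pow_three_eq_one hχ]
  rw [this, MulChar.pow_apply' χ two_ne_zero]

lemma MulChar.apply_neg_one_of_orderOf_eq_three {F : Type*} [Field F]
    {χ : MulChar F ℂ} (hχ : orderOf χ = 3) :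
    χ (-1) = 1 := by
  have h3 := MulChar.apply_pow_three hχ (x := -1) (neg_ne_zero.2 one_ne_zero)
  have h2 : χ (-1) ^ 2 = 1 := by rw [← map_pow]; simp
  calc χ (-1) = χ (-1) * χ (-1) ^ 2 := by rw [h2, mul_one]
    _ = 1 := by rw [← pow_succ', h3]

section CubicCharacter

variable {F : Type*} [Field F] [Fintype F]

/-- Both sides say that `x` is a cube. -/
lemma MulChar.apply_eq_one_iff_pow_eq_one {χ : MulChar F ℂ} (hχ : orderOf χ = 3) {a : ℕ}
    (ha : Fintype.card F = 3 * a + 1) {x : F} (hx : x ≠ 0) : χ x = 1 ↔ x ^ a = 1 := by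
  classical
  obtain ⟨g, hg⟩ := IsCyclic.exists_monoid_generator (α := Fˣ)
  obtain ⟨k, hk⟩ := (Submonoid.mem_powers_iff _ _).1 (hg (Units.mk0 x hx))
  have hxk : x = (g : F) ^ k := by
    rw [← Units.val_pow_eq_pow_val, hk, Units.val_mk0]
  have ha0 : 0 < a := by have := Fintype.one_lt_card (α := F); omega
  have hgord : orderOf g = 3 * a := by
    rw [orderOf_eq_card_of_forall_mem_powers hg, Nat.card_eq_fintype_card, Fintype.card_units, ha]
    rfl
  have hχg : orderOf (χ g) = 3 := by
    refine orderOf_eq_prime (MulChar.apply_pow_three hχ g.ne_zero) fun h1 => ?_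
    have : χ = 1 := (MulChar.eq_iff (g := g)
      (fun y => (Submonoid.powers_le_zpowers g) (hg y)) _ _).2 (by simp [h1])
    rw [this, orderOf_one] at hχ
    omega
  rw [hxk, map_pow, ← orderOf_dvd_iff_pow_eq_one, hχg, ← pow_mul, ← Units.val_pow_eq_pow_val,
    Units.val_eq_one, ← orderOf_dvd_iff_pow_eq_one, hgord]
  exact (Nat.mul_dvd_mul_iff_right ha0).symm

end CubicCharacter

lemma IsPrimitiveRoot.sq_add_self_add_one_eq_zero {ω : ℂ} (hω : IsPrimitiveRoot ω 3) :
    ω ^ 2 + ω + 1 = 0 := by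
  have := hω.geom_sum_eq_zero (by norm_num)
  simp only [Finset.sum_range_succ, Finset.sum_range_zero] at this
  linear_combination this

lemma IsPrimitiveRoot.star_eq_sq {ω : ℂ} (hω : IsPrimitiveRoot ω 3) : star ω = ω ^ 2 := by
  have : star ω = ω⁻¹ := (Complex.inv_eq_conj (hω.norm'_eq_one (by norm_num))).symm
  rw [this]
  exact inv_eq_of_mul_eq_one_right (by rw [← pow_succ', hω.pow_eq_one])

lemma exists_eq_add_mul_of_mem_adjoin {μ : ℂ} (hμ : IsPrimitiveRoot μ 3) {z : ℂ}
    (hz : z ∈ Algebra.adjoin ℤ {μ}) : ∃ u v : ℤ, z = u + v * μ := by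
  have h1 := hμ.sq_add_self_add_one_eq_zero
  induction hz using Algebra.adjoin_induction with
  | mem x hx => exact ⟨0, 1, by simpa using hx⟩
  | algebraMap r => exact ⟨r, 0, by simp⟩
  | add x y _ _ hx hy =>
    obtain ⟨u, v, rfl⟩ := hx
    obtain ⟨u', v', rfl⟩ := hy
    exact ⟨u + u', v + v', by push_cast; ring⟩
  | mul x y _ _ hx hy =>
    obtain ⟨u, v, rfl⟩ := hx
    obtain ⟨u', v', rfl⟩ := hy
    exact ⟨u * u' - v * v', u * v' + v * u' - v * v', by
      push_cast; linear_combination (v * v' : ℂ) * h1⟩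

section Jacobi

variable {F : Type*} [Field F] [Fintype F]

lemma jacobiSum_inv_eq_star (χ : MulChar F ℂ) :
    jacobiSum χ⁻¹ χ⁻¹ = star (jacobiSum χ χ) := by
  simp only [jacobiSum, star_sum, star_mul', MulChar.star_apply']

lemma jacobiSum_mul_star {χ : MulChar F ℂ} (hχ : orderOf χ = 3) :
    jacobiSum χ χ * star (jacobiSum χ χ) = Fintype.card F := by
  have h1 : χ ≠ 1 := by rintro rfl; simp at hχ
  have h2 : χ * χ ≠ 1 := by
    rw [← pow_two]; intro h
    have := orderOf_dvd_of_pow_eq_one h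
    rw [hχ] at this
    omega
  rw [← jacobiSum_inv_eq_star]
  refine jacobiSum_mul_jacobiSum_inv ?_ h1 h1 h2
  rw [ringChar.eq_zero]
  exact (CharP.ringChar_ne_zero_of_finite F).symm

/-- In `ℤ[ω]`, the Jacobi sum of a cubic character is `≡ -1` modulo `3`; its trace is the
integer of cubic cyclotomy. -/
lemma exists_trace_jacobiSum {χ : MulChar F ℂ} (hχ : orderOf χ = 3) :
    ∃ c : ℤ, c ≡ 1 [ZMOD 3] ∧ (∃ d : ℤ, 4 * (Fintype.card F : ℤ) = c ^ 2 + 27 * d ^ 2) ∧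
      jacobiSum χ χ + star (jacobiSum χ χ) = c := by
  have hμ := Complex.isPrimitiveRoot_exp 3 (by norm_num)
  set μ : ℂ := Complex.exp (2 * Real.pi * Complex.I / (3 : ℕ))
  have h1 := hμ.sq_add_self_add_one_eq_zero
  have h3 := MulChar.pow_three_eq_one hχ
  obtain ⟨z, hz, hJ⟩ := exists_jacobiSum_eq_neg_one_add (by norm_num : 2 < 3) h3 h3
    (hχ ▸ MulChar.orderOf_dvd_card_sub_one F χ) hμ
  obtain ⟨u, v, rfl⟩ := exists_eq_add_mul_of_mem_adjoin hμ hz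
  -- Here `(μ - 1)² = -3μ` produces the divisibility by `3`.
  have hJ' : jacobiSum χ χ = (3 * v - 1) + 3 * (v - u) * μ := by
    rw [hJ]
    linear_combination (u - 3 * v + v * μ : ℂ) * h1
  have hJs : star (jacobiSum χ χ) = (3 * v - 1) + 3 * (v - u) * μ ^ 2 := by
    rw [hJ', ← hμ.star_eq_sq]
    simp
  refine ⟨3 * (u + v) - 2, ?_, ⟨v - u, ?_⟩, ?_⟩
  · exact (Int.modEq_iff_dvd.2 ⟨1 - (u + v), by ring⟩)
  · have h := jacobiSum_mul_star hχ
    rw [hJs, hJ'] at h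
    have h' : (4 * (Fintype.card F : ℂ)) = (3 * (u + v) - 2 : ℂ) ^ 2 + 27 * (v - u : ℂ) ^ 2 := by
      rw [← h]
      linear_combination (4 * (3 * v - 1) * 3 * (v - u) +
        4 * 9 * (v - u) ^ 2 * (μ - 1) : ℂ) * h1
    exact_mod_cast h'
  · rw [hJs, hJ']
    push_cast
    linear_combination (3 * (v - u) : ℂ) * h1

end Jacobi

/-! ### The trace of the Jacobi sum modulo the characteristic -/

section ModP

variable {F : Type*} [Field F] [Fintype F]

lemma sum_mul_one_sub_pow {a : ℕ} (ha0 : 0 < a) (ha : Fintype.card F = 3 * a + 1) :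
    ∑ x : F, (x * (1 - x)) ^ a = 0 := by
  have h : ∀ x : F, (x * (1 - x)) ^ a =
      ∑ k ∈ Finset.range (a + 1), ((-1) ^ k * (a.choose k : F)) * x ^ (a + k) := by
    intro x
    rw [mul_pow, sub_eq_neg_add, add_pow, Finset.mul_sum]
    refine Finset.sum_congr rfl fun k _ => ?_
    rw [neg_pow x, pow_add]
    ring
  simp_rw [h]
  rw [Finset.sum_comm]
  refine Finset.sum_eq_zero fun k hk => ?_
  rw [Finset.mem_range] at hk
  rw [← Finset.mul_sum, FiniteField.sum_pow_lt_card_sub_one, mul_zero]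
  omega

lemma sum_pow_eq_ite {i : ℕ} (hi : 0 < i) (h2 : i < 2 * (Fintype.card F - 1)) :
    ∑ x : F, x ^ i = if i = Fintype.card F - 1 then -1 else 0 := by
  classical
  rw [Fintype.sum_eq_add_sum_subtype_ne _ (0 : F), zero_pow hi.ne', zero_add,
    ← unitsEquivNeZero.sum_comp fun x : {x : F // x ≠ 0} => (x : F) ^ i]
  simp only [unitsEquivNeZero_apply_coe, FiniteField.sum_pow_units]
  have : Fintype.card F - 1 ∣ i ↔ i = Fintype.card F - 1 := by
    constructor
    · rintro ⟨k, rfl⟩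
      have : k < 2 := by
        by_contra hk
        have := Nat.mul_le_mul_left (Fintype.card F - 1) (not_lt.1 hk)
        omega
      interval_cases k <;> omega
    · rintro rfl; rfl
  simp only [this]

lemma sum_mul_one_sub_pow_two_mul {a : ℕ} (ha0 : 0 < a) (ha : Fintype.card F = 3 * a + 1) :
    ∑ x : F, (x * (1 - x)) ^ (2 * a) = (-1) ^ (a + 1) * ((2 * a).choose a : F) := by
  have h : ∀ x : F, (x * (1 - x)) ^ (2 * a) =
      ∑ k ∈ Finset.range (2 * a + 1), ((-1) ^ k * ((2 * a).choose k : F)) * x ^ (2 * a + k) := by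
    intro x
    rw [mul_pow, sub_eq_neg_add, add_pow, Finset.mul_sum]
    refine Finset.sum_congr rfl fun k _ => ?_
    rw [neg_pow x, pow_add]
    ring
  simp_rw [h]
  rw [Finset.sum_comm, Finset.sum_eq_single a]
  · rw [← Finset.mul_sum, sum_pow_eq_ite (by omega) (by omega), if_pos (by omega)]
    ring
  · intro k hk hka
    rw [Finset.mem_range] at hk
    rw [← Finset.mul_sum, sum_pow_eq_ite (by omega) (by omega), if_neg (by omega), mul_zero]
  · intro h
    exact absurd (Finset.mem_range.2 (by omega)) h

/-- The trace of the Jacobi sum is `∑ t(x(1 - x))` with `t(y) = 2` on nonzero cubes, `-1` on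
non-cubes and `0` at `0`. In `F`, `t(y) = y ^ a + y ^ (2 * a)` with `a = (q - 1) / 3`, and the power
sums evaluate the total. -/
lemma intCast_trace_jacobiSum {χ : MulChar F ℂ} (hχ : orderOf χ = 3) {a : ℕ}
    (ha : Fintype.card F = 3 * a + 1) {c : ℤ}
    (hc : jacobiSum χ χ + star (jacobiSum χ χ) = c) :
    (c : F) = (-1) ^ (a + 1) * ((2 * a).choose a : F) := by
  classical
  have ha0 : 0 < a := by have := Fintype.one_lt_card (α := F); omega
  let t : F → ℤ := fun y => if y = 0 then 0 else if y ^ a = 1 then 2 else -1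
  have htF : ∀ y : F, y ^ a + y ^ (2 * a) = (t y : F) := by
    intro y
    by_cases hy : y = 0
    · simp [t, hy, ha0.ne']
    · simp only [t, if_neg hy]
      rw [mul_comm 2 a, pow_mul]
      refine add_sq_of_pow_three_eq_one ?_
      rw [← pow_mul, ← FiniteField.pow_card_sub_one_eq_one y hy, ha]
      congr 1
      omega
  have htC : ∀ y : F, χ y + χ y ^ 2 = (t y : ℂ) := by
    intro y
    by_cases hy : y = 0
    · simp [t, hy, MulChar.map_zero]
    · simp only [t, if_neg hy, ← MulChar.apply_eq_one_iff_pow_eq_one hχ ha hy]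
      exact add_sq_of_pow_three_eq_one (MulChar.apply_pow_three hχ hy)
  have hcs : c = ∑ x : F, t (x * (1 - x)) := by
    have : (c : ℂ) = ((∑ x : F, t (x * (1 - x)) : ℤ) : ℂ) := by
      rw [← hc, ← jacobiSum_inv_eq_star]
      push_cast
      simp only [jacobiSum, ← Finset.sum_add_distrib, ← htC, MulChar.inv_apply_eq_sq hχ, map_mul,
        mul_pow]
    exact_mod_cast this
  rw [hcs]
  push_cast
  simp only [← htF]
  rw [Finset.sum_add_distrib, sum_mul_one_sub_pow ha0 ha, sum_mul_one_sub_pow_two_mul ha0 ha,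
    zero_add]

theorem isCubicCyclotomicInt_trace_jacobiSum {χ : MulChar F ℂ} (hχ : orderOf χ = 3) :
    ∃ c : ℤ, IsCubicCyclotomicInt (Fintype.card F) c ∧
      jacobiSum χ χ + star (jacobiSum χ χ) = c := by
  obtain ⟨c, hc, hd, hJ⟩ := exists_trace_jacobiSum hχ
  refine ⟨c, ⟨hc, hd, fun p hp hpq hp3 hpc => ?_⟩, hJ⟩
  obtain ⟨a, ha⟩ : ∃ a, Fintype.card F = 3 * a + 1 := by
    obtain ⟨a, ha⟩ := hχ ▸ MulChar.orderOf_dvd_card_sub_one F χ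
    exact ⟨a, by have := Fintype.one_lt_card (α := F); omega⟩
  obtain ⟨n, hr, hcard⟩ := FiniteField.card F (ringChar F)
  obtain rfl : p = ringChar F := by
    rw [hcard] at hpq
    exact (Nat.prime_dvd_prime_iff_eq hp hr).1 (hp.dvd_of_dvd_pow hpq)
  have h0 : (c : F) = 0 := (CharP.intCast_eq_zero_iff F (ringChar F) c).2 hpc
  rw [intCast_trace_jacobiSum hχ ha hJ] at h0
  have h1 : ((2 * a).choose a : F) = 0 :=
    (mul_eq_zero.1 h0).resolve_left (pow_ne_zero _ (neg_ne_zero.2 one_ne_zero))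
  exact not_dvd_choose_two_mul hp hp3 n (hcard ▸ ha)
    ((CharP.cast_eq_zero_iff F (ringChar F) _).1 h1)

end ModP

/-! ### The determinant -/

section Determinant

variable {F : Type*} [Field F] [Fintype F] [DecidableEq F]

/-- The character table `(ψ (x * a))` of the additive group of `F`. -/
noncomputable def additiveFourierMatrix (ψ : AddChar F ℂ) : Matrix F F ℂ :=
  Matrix.of fun x a => ψ (x * a)

lemma det_additiveFourierMatrix_ne_zero {ψ : AddChar F ℂ} (hψ : ψ.IsPrimitive) :
    (additiveFourierMatrix ψ).det ≠ 0 := by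
  have h : additiveFourierMatrix ψ * Matrix.of (fun a x => ψ (-(x * a))) =
      (Fintype.card F : ℂ) • (1 : Matrix F F ℂ) := by
    ext x y
    simp only [additiveFourierMatrix, Matrix.mul_apply, Matrix.of_apply, Matrix.smul_apply,
      Matrix.one_apply, smul_eq_mul, ← AddChar.map_add_eq_mul]
    have : ∀ a : F, x * a + -(y * a) = a * (x - y) := fun a => by ring
    simp only [this, AddChar.sum_mulShift _ hψ, sub_eq_zero]
    split_ifs <;> simp
  intro h0
  have h1 := congrArg Matrix.det h
  rw [Matrix.det_mul, h0, zero_mul, Matrix.det_smul, Matrix.det_one, mul_one] at h1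
  exact pow_ne_zero _ (Nat.cast_ne_zero.2 Fintype.card_ne_zero) h1.symm

/-- The columns of the Fourier matrix are eigenvectors of the Paley core; the eigenvalues are
Gauss sums. -/
lemma paleyCore_mul_additiveFourierMatrix (χ : MulChar F ℂ) (ψ : AddChar F ℂ) :
    paleyCore χ * additiveFourierMatrix ψ =
      additiveFourierMatrix ψ * Matrix.diagonal fun a => gaussSum χ (ψ.mulShift (-a)) := by
  ext x a
  rw [Matrix.mul_diagonal, Matrix.mul_apply]
  simp only [paleyCore, additiveFourierMatrix, Matrix.of_apply, gaussSum, Finset.mul_sum]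
  refine Fintype.sum_equiv (Equiv.subLeft x) _ _ fun j => ?_
  rw [Equiv.subLeft_apply, AddChar.mulShift_apply, mul_left_comm, ← AddChar.map_add_eq_mul]
  congr 2
  ring

/-- In the Fourier basis the bordered matrix is diagonal except for the border, which couples the
point at infinity to the trivial additive character only. -/
lemma det_paleyWeighing_add_smul_one (χ : MulChar F ℂ) {ψ : AddChar F ℂ} (hψ : ψ.IsPrimitive)
    {ω : ℂ} (h0 : ∀ a, gaussSum χ (ψ.mulShift (-a)) + ω ≠ 0) :
    (paleyWeighing χ + ω • (1 : Matrix (Unit ⊕ F) (Unit ⊕ F) ℂ)).det =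
      (∏ a, (gaussSum χ (ψ.mulShift (-a)) + ω)) *
        (ω - Fintype.card F * (gaussSum χ (ψ.mulShift 0) + ω)⁻¹) := by
  set e : F → ℂ := fun a => gaussSum χ (ψ.mulShift (-a)) + ω with he
  set Ψ := additiveFourierMatrix ψ with hΨ
  set P : Matrix (Unit ⊕ F) (Unit ⊕ F) ℂ := Matrix.fromBlocks 1 0 0 Ψ with hP
  set r : Matrix Unit F ℂ := Matrix.of fun _ a => if a = 0 then (Fintype.card F : ℂ) else 0 with hr
  set s : Matrix F Unit ℂ := Matrix.of fun a _ => if a = 0 then 1 else 0 with hs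
  set B : Matrix (Unit ⊕ F) (Unit ⊕ F) ℂ :=
    Matrix.fromBlocks (ω • 1) r s (Matrix.diagonal e) with hB
  have hPdet : P.det ≠ 0 := by
    rw [hP, Matrix.det_fromBlocks_zero₂₁, Matrix.det_one, one_mul]
    exact det_additiveFourierMatrix_ne_zero hψ
  have hconj : (paleyWeighing χ + ω • (1 : Matrix (Unit ⊕ F) (Unit ⊕ F) ℂ)) * P = P * B := by
    rw [paleyWeighing, ← Matrix.fromBlocks_one, Matrix.fromBlocks_smul, Matrix.fromBlocks_add, hP,
      hB, Matrix.fromBlocks_multiply, Matrix.fromBlocks_multiply]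
    congr 1
    · simp
    · ext i a
      simp only [hr, hΨ, additiveFourierMatrix, smul_zero, add_zero, zero_add,
        Matrix.mul_zero, Matrix.zero_mul, Matrix.one_mul, Matrix.mul_apply, Matrix.of_apply,
        one_mul, AddChar.sum_mulShift _ hψ]
      split_ifs <;> simp
    · ext x i
      simp [hs, hΨ, additiveFourierMatrix, Matrix.mul_apply]
    · have : Matrix.diagonal e =
          Matrix.diagonal (fun a => gaussSum χ (ψ.mulShift (-a))) + ω • (1 : Matrix F F ℂ) := by
        rw [Matrix.smul_one_eq_diagonal, Matrix.diagonal_add]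
      rw [this, Matrix.mul_add, hΨ, ← paleyCore_mul_additiveFourierMatrix]
      simp [Matrix.add_mul]
  have hdet := congrArg Matrix.det hconj
  rw [Matrix.det_mul, Matrix.det_mul, mul_comm P.det] at hdet
  rw [mul_right_cancel₀ hPdet hdet, hB]
  let inv : Invertible (Matrix.diagonal e) :=
    ⟨Matrix.diagonal fun a => (e a)⁻¹, by simp [Matrix.diagonal_mul_diagonal, he, h0],
      by simp [Matrix.diagonal_mul_diagonal, he, h0]⟩
  rw [Matrix.det_fromBlocks₂₂, Matrix.det_diagonal]
  congr 1
  rw [Matrix.det_unique]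
  have : ⅟(Matrix.diagonal e) = Matrix.diagonal fun a => (e a)⁻¹ := rfl
  rw [this, Matrix.sub_apply, Matrix.mul_apply]
  simp [hr, hs, Matrix.mul_diagonal, he]

/-- Translation by an element on which `χ` is nontrivial permutes the factors, so the cube of the
product regroups into factors `(z G + ω) (ζ z G + ω) (ζ² z G + ω) = G ^ 3 + 1`. -/
lemma prod_units_pow_three {χ : MulChar F ℂ} (hχ : orderOf χ = 3) {ω : ℂ} (hω : ω ^ 3 = 1)
    (G : ℂ) :
    (∏ a : Fˣ, (χ a * G + ω)) ^ 3 = (G ^ 3 + 1) ^ (Fintype.card F - 1) := by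
  obtain ⟨g, hg⟩ : ∃ g : Fˣ, χ g ≠ 1 := MulChar.ne_one_iff.1 (by rintro rfl; simp at hχ)
  have h3 : χ g ^ 3 = 1 := MulChar.apply_pow_three hχ g.ne_zero
  set ζ := χ g with hζ
  have hζ0 : 1 + ζ + ζ ^ 2 = 0 :=
    (mul_eq_zero.1 (show (ζ - 1) * (1 + ζ + ζ ^ 2) = 0 by linear_combination h3)).resolve_left
      (sub_ne_zero.2 hg)
  have h1 : ∏ a : Fˣ, (χ a * G + ω) = ∏ a : Fˣ, (ζ * χ a * G + ω) := by
    rw [← Equiv.prod_comp (Equiv.mulLeft g)]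
    simp [hζ]
  have h2 : ∏ a : Fˣ, (χ a * G + ω) = ∏ a : Fˣ, (ζ ^ 2 * χ a * G + ω) := by
    rw [h1, ← Equiv.prod_comp (Equiv.mulLeft g)]
    simp [hζ, pow_two, mul_assoc]
  calc (∏ a : Fˣ, (χ a * G + ω)) ^ 3
      = (∏ a : Fˣ, (χ a * G + ω)) * (∏ a : Fˣ, (ζ * χ a * G + ω)) *
          ∏ a : Fˣ, (ζ ^ 2 * χ a * G + ω) := by rw [← h1, ← h2]; ring
    _ = ∏ a : Fˣ, (G ^ 3 + 1) := by
      rw [← Finset.prod_mul_distrib, ← Finset.prod_mul_distrib]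
      refine Finset.prod_congr rfl fun a _ => ?_
      have ha := MulChar.apply_pow_three hχ a.ne_zero
      linear_combination ζ ^ 3 * G ^ 3 * ha + G ^ 3 * h3 + hω +
        (χ a * G * ω ^ 2 + ζ * (χ a * G) ^ 2 * ω) * hζ0
    _ = _ := by rw [Finset.prod_const, Finset.card_univ, Fintype.card_units]

end Determinant

lemma gaussSum_pow_three {F : Type*} [Field F] [Fintype F] {χ : MulChar F ℂ} (hχ : orderOf χ = 3)
    {ψ : AddChar F ℂ} (hψ : ψ.IsPrimitive) :
    gaussSum χ ψ ^ 3 = Fintype.card F * jacobiSum χ χ := by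
  have h := gaussSum_pow_eq_prod_jacobiSum (χ := χ) (by omega) hψ
  rw [hχ, MulChar.apply_neg_one_of_orderOf_eq_three hχ] at h
  simpa using h

lemma norm_primitiveRoot_sq_sub_natCast {ω : ℂ} (hω : IsPrimitiveRoot ω 3) (q : ℕ) :
    ‖ω ^ 2 - q‖ = √((q : ℝ) ^ 2 + q + 1) := by
  have h1 := hω.sq_add_self_add_one_eq_zero
  refine (Real.sqrt_eq_iff_mul_self_eq (by positivity) (norm_nonneg _)).2 ?_ |>.symm
  rw [← pow_two]
  have h : ((‖ω ^ 2 - q‖ ^ 2 : ℝ) : ℂ) = (((q : ℝ) ^ 2 + q + 1 : ℝ) : ℂ) := by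
    rw [Complex.ofReal_pow, ← Complex.mul_conj']
    have : (starRingEnd ℂ) (ω ^ 2 - q) = ω ^ 4 - q := by
      rw [map_sub, map_pow, map_natCast, ← Complex.star_def, hω.star_eq_sq]; ring
    rw [this]
    push_cast
    linear_combination ((ω ^ 3 + 1) * (ω - 1) - q * (ω ^ 2 - ω + 1)) * h1
  exact_mod_cast h.symm

lemma norm_gaussSum_pow_three_add_one_sq {F : Type*} [Field F] [Fintype F] {χ : MulChar F ℂ}
    (hχ : orderOf χ = 3) {ψ : AddChar F ℂ} (hψ : ψ.IsPrimitive) {c : ℤ}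
    (hc : jacobiSum χ χ + star (jacobiSum χ χ) = c) :
    ‖gaussSum χ ψ ^ 3 + 1‖ ^ 2 = (Fintype.card F : ℝ) ^ 3 + c * Fintype.card F + 1 := by
  have h : ((‖gaussSum χ ψ ^ 3 + 1‖ ^ 2 : ℝ) : ℂ) =
      (((Fintype.card F : ℝ) ^ 3 + c * Fintype.card F + 1 : ℝ) : ℂ) := by
    rw [Complex.ofReal_pow, ← Complex.mul_conj', gaussSum_pow_three hχ hψ]
    have h2 := jacobiSum_mul_star hχ
    rw [map_add, map_mul, map_natCast, map_one, ← Complex.star_def]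
    push_cast
    linear_combination (Fintype.card F : ℂ) ^ 2 * h2 + (Fintype.card F : ℂ) * hc
  exact_mod_cast h

lemma gaussSum_pow_three_add_one_ne_zero {F : Type*} [Field F] [Fintype F] {χ : MulChar F ℂ}
    (hχ : orderOf χ = 3) {ψ : AddChar F ℂ} (hψ : ψ.IsPrimitive) : gaussSum χ ψ ^ 3 + 1 ≠ 0 := by
  intro h
  have h1 : (Fintype.card F : ℂ) * jacobiSum χ χ = -1 := by
    rw [← gaussSum_pow_three hχ hψ]; linear_combination h
  have h2 := congrArg star h1
  rw [star_mul', star_natCast, star_neg, star_one] at h2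
  have h3 : (Fintype.card F : ℂ) ^ 3 = 1 := by
    linear_combination (Fintype.card F : ℂ) * star (jacobiSum χ χ) * h1 - h2 -
      (Fintype.card F : ℂ) ^ 2 * jacobiSum_mul_star hχ
  have h4 : Fintype.card F ^ 3 = 1 := by exact_mod_cast h3
  have h5 := Fintype.one_lt_card (α := F)
  exact absurd (Nat.pow_eq_one.1 h4) (by omega)

theorem norm_det_paleyWeighing_add_smul_one {F : Type*} [Field F] [Fintype F] [DecidableEq F]
    {χ : MulChar F ℂ} (hχ : orderOf χ = 3) {ω : ℂ} (hω : IsPrimitiveRoot ω 3) {c : ℤ}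
    (hc : jacobiSum χ χ + star (jacobiSum χ χ) = c) :
    ‖(paleyWeighing χ + ω • (1 : Matrix (Unit ⊕ F) (Unit ⊕ F) ℂ)).det‖ =
      paleyDetValue (Fintype.card F) c := by
  set ψ := AddChar.FiniteField.primitiveChar_to_Complex F
  have hψ : ψ.IsPrimitive := AddChar.FiniteField.primitiveChar_to_Complex_isPrimitive F
  set G := gaussSum χ ψ with hG
  have hχ1 : χ ≠ 1 := by rintro rfl; simp at hχ
  have hω0 : ω ≠ 0 := hω.ne_zero (by norm_num)
  have hinv : orderOf χ⁻¹ = 3 := by rw [orderOf_inv, hχ]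
  have hzero : gaussSum χ (ψ.mulShift 0) = 0 := by
    rw [AddChar.mulShift_zero, gaussSum_one_right hχ1]
  have hunit : ∀ a : Fˣ, gaussSum χ (ψ.mulShift (-(a : F))) = χ⁻¹ a * G := by
    intro a
    rw [← Units.val_neg, gaussSum_mulShift_eq, Units.val_neg, neg_eq_neg_one_mul, map_mul,
      MulChar.apply_neg_one_of_orderOf_eq_three hinv, one_mul]
  have hne : ∀ a : F, gaussSum χ (ψ.mulShift (-a)) + ω ≠ 0 := by
    intro a
    by_cases ha : a = 0
    · rwa [ha, neg_zero, hzero, zero_add]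
    · intro h
      rw [← Units.val_mk0 ha, hunit] at h
      have h3 := MulChar.apply_pow_three hinv ha
      rw [Units.val_mk0] at h
      refine gaussSum_pow_three_add_one_ne_zero hχ hψ ?_
      rw [← hG]
      have e : (χ⁻¹ a * G) ^ 3 = (-ω) ^ 3 := by rw [eq_neg_of_add_eq_zero_left h]
      linear_combination e - G ^ 3 * h3 - hω.pow_eq_one
  rw [det_paleyWeighing_add_smul_one χ hψ hne, Fintype.prod_eq_mul_prod_subtype_ne _ (0 : F),
    ← unitsEquivNeZero.prod_comp]
  simp only [unitsEquivNeZero_apply_coe, hunit, neg_zero, hzero, zero_add]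
  set P := ∏ a : Fˣ, (χ⁻¹ a * G + ω) with hP
  have e1 : ω * P * (ω - Fintype.card F * ω⁻¹) = (ω ^ 2 - Fintype.card F) * P := by
    field_simp
  rw [e1, norm_mul, norm_primitiveRoot_sq_sub_natCast hω, paleyDetValue]
  congr 1
  have hP3 : ‖P‖ ^ 3 = ‖G ^ 3 + 1‖ ^ (Fintype.card F - 1) := by
    rw [← norm_pow, prod_units_pow_three hinv hω.pow_eq_one, norm_pow]
  have hsq := norm_gaussSum_pow_three_add_one_sq hχ hψ hc
  have e2 : ((Fintype.card F : ℝ) + 2) ^ 3 - 3 * ((Fintype.card F : ℝ) + 2) ^ 2 -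
      3 * ((Fintype.card F : ℝ) - 1) * ((Fintype.card F : ℝ) + 2) +
      (3 + (c : ℝ)) * Fintype.card F - 1 = ‖G ^ 3 + 1‖ ^ 2 := by rw [hsq]; ring
  rw [e2]
  have hN : 0 ≤ ‖G ^ 3 + 1‖ := norm_nonneg _
  have hcard : ((Fintype.card F - 1 : ℕ) : ℝ) = (Fintype.card F : ℝ) - 1 := by
    rw [Nat.cast_sub Fintype.card_pos, Nat.cast_one]
  refine (pow_left_inj₀ (norm_nonneg _) (by positivity) three_ne_zero).1 ?_
  rw [hP3, ← Real.rpow_natCast, ← Real.rpow_natCast, ← Real.rpow_natCast, ← Real.rpow_mul hN,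
    ← Real.rpow_mul hN, hcard]
  congr 1
  push_cast
  ring

lemma isOverThirdRoots_paleyWeighing_add {F : Type*} [Field F] [DecidableEq F]
    {χ : MulChar F ℂ} (hχ : orderOf χ = 3) {ω : ℂ} (hω : ω ^ 3 = 1) :
    IsOverThirdRoots (paleyWeighing χ + ω • (1 : Matrix (Unit ⊕ F) (Unit ⊕ F) ℂ)) := by
  rintro (i | i) (j | j)
  · simp [paleyWeighing, hω]
  · simp [paleyWeighing]
  · simp [paleyWeighing]
  · by_cases h : i = j
    · simp [paleyWeighing, paleyCore, h, hω, MulChar.map_zero]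
    · simp [paleyWeighing, paleyCore, h, MulChar.apply_pow_three hχ (sub_ne_zero.2 h)]

/-! ### Comparison with the Barba bound -/

lemma abs_cubicCyclotomicInt_le {q : ℕ} {c : ℤ} (h : IsCubicCyclotomicInt q c) :
    |(c : ℝ)| ≤ 2 * √(q : ℝ) := by
  obtain ⟨-, ⟨d, hd⟩, -⟩ := h
  have h1 : (4 * q : ℝ) = (c : ℝ) ^ 2 + 27 * (d : ℝ) ^ 2 := by exact_mod_cast hd
  refine abs_le_of_sq_le_sq ?_ (by positivity)
  rw [mul_pow, Real.sq_sqrt (by positivity)]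
  nlinarith [sq_nonneg (d : ℝ)]

/-- Squeeze `log (1 + x)` between `1 - (1 + x)⁻¹` and `x`. -/
lemma tendsto_one_add_rpow_one {l : Filter ℕ} {x y : ℕ → ℝ} (hx : Tendsto x l (𝓝 0))
    (hy : ∀ n, 0 ≤ y n) (hxy : Tendsto (fun n => y n * x n) l (𝓝 0)) :
    Tendsto (fun n => (1 + x n) ^ y n) l (𝓝 1) := by
  have hpos : ∀ᶠ n in l, 0 < 1 + x n := by
    filter_upwards [hx.eventually (lt_mem_nhds (by norm_num : (-1 : ℝ) < 0))] with n hn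
    linarith
  have h1 : Tendsto (fun n => 1 + x n) l (𝓝 1) := by simpa using hx.const_add 1
  have hlow : Tendsto (fun n => y n * (1 - (1 + x n)⁻¹)) l (𝓝 0) := by
    have h2 : Tendsto (fun n => y n * x n * (1 + x n)⁻¹) l (𝓝 0) := by
      simpa using hxy.mul (h1.inv₀ one_ne_zero)
    refine h2.congr' ?_
    filter_upwards [hpos] with n hn
    field_simp
    ring
  have hlog : Tendsto (fun n => y n * Real.log (1 + x n)) l (𝓝 0) := by
    refine tendsto_of_tendsto_of_tendsto_of_le_of_le' hlow hxy ?_ ?_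
    · filter_upwards [hpos] with n hn
      exact mul_le_mul_of_nonneg_left (Real.one_sub_inv_le_log_of_pos hn) (hy n)
    · filter_upwards [hpos] with n hn
      refine mul_le_mul_of_nonneg_left ?_ (hy n)
      linarith [Real.log_le_sub_one_of_pos hn]
  have := (Real.continuous_exp.tendsto 0).comp hlog
  rw [Real.exp_zero] at this
  refine this.congr' ?_
  filter_upwards [hpos] with n hn
  rw [Function.comp_apply, Real.rpow_def_of_pos hn, mul_comm]

lemma paleyDetValue_div_barbaBound {q : ℕ} (hq : 0 < q) (c : ℤ)
    (hc : 0 ≤ 1 + ((c : ℝ) / q ^ 2 + 1 / q ^ 3)) :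
    paleyDetValue q c / barbaBound (q + 1) =
      √((1 + 1 / q + 1 / q ^ 2) / (2 + 1 / q)) *
        (1 + ((c : ℝ) / q ^ 2 + 1 / q ^ 3)) ^ (((q : ℝ) - 1) / 6) := by
  have hq0 : (0 : ℝ) < q := by exact_mod_cast hq
  have e1 : ((q : ℝ) + 2) ^ 3 - 3 * ((q : ℝ) + 2) ^ 2 - 3 * ((q : ℝ) - 1) * ((q : ℝ) + 2)
      + (3 + (c : ℝ)) * q - 1 = (q : ℝ) ^ 3 * (1 + ((c : ℝ) / q ^ 2 + 1 / q ^ 3)) := by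
    field_simp
    ring
  have e2 : 2 * ((q + 1 : ℕ) : ℝ) - 1 = 2 * q + 1 := by push_cast; ring
  have e3 : ((q + 1 : ℕ) : ℝ) - 1 = q := by push_cast; ring
  have e4 : ((q : ℝ) ^ 3) ^ (((q : ℝ) - 1) / 6) = (q : ℝ) ^ ((q : ℝ) / 2) / √q := by
    rw [Real.sqrt_eq_rpow, ← Real.rpow_sub hq0, ← Real.rpow_natCast, ← Real.rpow_mul hq0.le]
    congr 1
    push_cast
    ring
  have e5 : (1 + 1 / q + 1 / q ^ 2) / (2 + 1 / q) = ((q : ℝ) ^ 2 + q + 1) / ((2 * q + 1) * q) := by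
    field_simp
  have h6 : (q : ℝ) ^ ((q : ℝ) / 2) ≠ 0 := (Real.rpow_pos_of_pos hq0 _).ne'
  rw [paleyDetValue, barbaBound, e1, e2, e3, Real.mul_rpow (by positivity) hc, e4, e5,
    Real.sqrt_div (by positivity), Real.sqrt_mul (by positivity)]
  field_simp

theorem tendsto_paleyDetValue_div_barbaBound {c : ℕ → ℤ} {S : Set ℕ}
    (hc : ∀ q ∈ S, |(c q : ℝ)| ≤ 2 * √(q : ℝ)) :
    Tendsto (fun q : ℕ => paleyDetValue q (c q) / barbaBound (q + 1)) (atTop ⊓ 𝓟 S)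
      (𝓝 (1 / √2)) := by
  set l := atTop ⊓ 𝓟 S with hl
  have hlt : l ≤ atTop := inf_le_left
  have hS : ∀ᶠ q in l, q ∈ S := mem_inf_of_right (mem_principal_self S)
  have hge : ∀ᶠ q : ℕ in l, 0 < q := hlt (eventually_gt_atTop 0)
  have hcast : Tendsto (fun q : ℕ => (q : ℝ)) l atTop := tendsto_natCast_atTop_atTop.mono_left hlt
  have hinv : Tendsto (fun q : ℕ => (1 : ℝ) / q) l (𝓝 0) := hcast.const_div_atTop 1
  have hinv2 : Tendsto (fun q : ℕ => (1 : ℝ) / q ^ 2) l (𝓝 0) := by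
    simpa using hinv.pow 2
  have hsqrt : Tendsto (fun q : ℕ => 3 / √(q : ℝ)) l (𝓝 0) :=
    (Real.tendsto_sqrt_atTop.comp hcast).const_div_atTop 3
  set x : ℕ → ℝ := fun q => (c q : ℝ) / q ^ 2 + 1 / q ^ 3 with hxdef
  have hqx : ∀ᶠ q : ℕ in l, (q : ℝ) * |x q| ≤ 3 / √(q : ℝ) := by
    filter_upwards [hS, hge] with q hq hq0
    have hq1 : (1 : ℝ) ≤ q := by exact_mod_cast hq0
    have hqpos : (0 : ℝ) < q := by linarith
    have hs : (0 : ℝ) < √(q : ℝ) := Real.sqrt_pos.2 hqpos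
    have hs1 : 1 ≤ √(q : ℝ) := Real.one_le_sqrt.2 hq1
    have hss : √(q : ℝ) ^ 2 = q := Real.sq_sqrt hqpos.le
    have h1 : |x q| ≤ 2 * √(q : ℝ) / q ^ 2 + 1 / q ^ 3 := by
      refine (abs_add_le _ _).trans (add_le_add ?_ ?_)
      · rw [abs_div, abs_of_pos (by positivity : (0 : ℝ) < (q : ℝ) ^ 2)]
        gcongr
        exact hc q hq
      · rw [abs_of_pos (by positivity)]
    refine (mul_le_mul_of_nonneg_left h1 hqpos.le).trans ?_
    have h2 : (q : ℝ) * (2 * √(q : ℝ) / q ^ 2 + 1 / q ^ 3) = 2 / √(q : ℝ) + 1 / q ^ 2 := by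
      have : (q : ℝ) * (2 * √(q : ℝ) / q ^ 2) = 2 / √(q : ℝ) := by
        field_simp
        rw [hss]
      rw [mul_add, this]
      field_simp
    rw [h2]
    have h3 : (1 : ℝ) / q ^ 2 ≤ 1 / √(q : ℝ) := by
      refine one_div_le_one_div_of_le hs ?_
      nlinarith [hss, sq_nonneg (√(q : ℝ) - 1)]
    calc 2 / √(q : ℝ) + 1 / (q : ℝ) ^ 2 ≤ 2 / √(q : ℝ) + 1 / √(q : ℝ) := by gcongr
      _ = 3 / √(q : ℝ) := by ring
  have hx : Tendsto x l (𝓝 0) := by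
    refine squeeze_zero_norm' ?_ hsqrt
    filter_upwards [hqx, hge] with q hq hq0
    have hq1 : (1 : ℝ) ≤ q := by exact_mod_cast hq0
    rw [Real.norm_eq_abs]
    nlinarith [abs_nonneg (x q)]
  -- Natural-number subtraction agrees with real subtraction for `q > 0`, and keeps the
  -- exponent nonnegative for `q = 0`.
  set y : ℕ → ℝ := fun q => ((q - 1 : ℕ) : ℝ) / 6 with hydef
  have hxy : Tendsto (fun q => y q * x q) l (𝓝 0) := by
    refine squeeze_zero_norm' ?_ hsqrt
    filter_upwards [hqx] with q hq
    rw [Real.norm_eq_abs, abs_mul, abs_of_nonneg (by positivity : 0 ≤ y q)]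
    refine le_trans (mul_le_mul_of_nonneg_right ?_ (abs_nonneg _)) hq
    have h1 : ((q - 1 : ℕ) : ℝ) ≤ q := by exact_mod_cast Nat.sub_le q 1
    have h2 : (0 : ℝ) ≤ q := by positivity
    simp only [hydef]
    linarith
  have hpow := tendsto_one_add_rpow_one hx (fun q => by positivity : ∀ q, 0 ≤ y q) hxy
  have hfrac : Tendsto (fun q : ℕ => √((1 + 1 / (q : ℝ) + 1 / q ^ 2) / (2 + 1 / q))) l
      (𝓝 (√((1 + 0 + 0) / (2 + 0)))) :=
    (Real.continuous_sqrt.tendsto _).comp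
      (((hinv.const_add 1).add hinv2).div (hinv.const_add 2) (by norm_num))
  have hlim := hfrac.mul hpow
  have e : √((1 + 0 + 0) / (2 + 0) : ℝ) * 1 = 1 / √2 := by
    rw [mul_one, add_zero, add_zero, add_zero, Real.sqrt_div zero_le_one, Real.sqrt_one]
  rw [e] at hlim
  refine hlim.congr' ?_
  filter_upwards [hge, hx.eventually (lt_mem_nhds (by norm_num : (-1 : ℝ) < 0))] with q hq hxq
  rw [paleyDetValue_div_barbaBound hq (c q) (by simp only [hxdef] at hxq; linarith)]
  simp only [hydef, hxdef]
  rw [Nat.cast_sub hq, Nat.cast_one]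

/-! ### Existence of the cubic cyclotomic integer, and the theorem -/

lemma exists_field_and_cubic_mulChar {q : ℕ} (hq : IsPrimePow q) (hq3 : q ≡ 1 [MOD 3]) :
    ∃ (F : Type) (_ : Field F) (_ : Fintype F) (χ : MulChar F ℂ),
      Fintype.card F = q ∧ orderOf χ = 3 := by
  obtain ⟨p, m, hp, hm, rfl⟩ := hq
  have : Fact p.Prime := ⟨hp.nat_prime⟩
  let _ : Fintype (GaloisField p m) := Fintype.ofFinite _
  have hcard : Fintype.card (GaloisField p m) = p ^ m := by
    rw [← Nat.card_eq_fintype_card, GaloisField.card p m hm.ne']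
  obtain ⟨χ, hχ⟩ := MulChar.exists_mulChar_orderOf (GaloisField p m) (n := 3) (R := ℂ)
    (by rw [hcard]; exact (Nat.modEq_iff_dvd' (Nat.pow_pos hp.nat_prime.pos)).1 hq3.symm)
    (Complex.isPrimitiveRoot_exp 3 (by norm_num))
  exact ⟨GaloisField p m, inferInstance, inferInstance, χ, hcard, hχ⟩

lemma exists_isCubicCyclotomicInt {q : ℕ} (hq : IsPrimePow q) (hq3 : q ≡ 1 [MOD 3]) :
    ∃ c : ℤ, IsCubicCyclotomicInt q c := by
  obtain ⟨F, _, _, χ, rfl, hχ⟩ := exists_field_and_cubic_mulChar hq hq3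
  obtain ⟨c, hc, -⟩ := isCubicCyclotomicInt_trace_jacobiSum hχ
  exact ⟨c, hc⟩

lemma norm_det_eq_paleyDetValue {F : Type*} [Field F] [Fintype F] [DecidableEq F]
    {c : ℤ} (hc : IsCubicCyclotomicInt (Fintype.card F) c)
    {χ : MulChar F ℂ} (hχ : orderOf χ = 3) {ω : ℂ} (hω : IsPrimitiveRoot ω 3) :
    ‖(paleyWeighing χ + ω • (1 : Matrix (Unit ⊕ F) (Unit ⊕ F) ℂ)).det‖ =
      paleyDetValue (Fintype.card F) c := by
  obtain ⟨c', hc', hJ⟩ := isCubicCyclotomicInt_trace_jacobiSum hχ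
  have h3 : Fintype.card F ≡ 1 [MOD 3] :=
    ((Nat.modEq_iff_dvd' Fintype.card_pos).2 (hχ ▸ MulChar.orderOf_dvd_card_sub_one F χ)).symm
  rw [← hc.unique (FiniteField.isPrimePow_card F) h3 hc']
  exact norm_det_paleyWeighing_add_smul_one hχ hω hJ

theorem mainTheorem5 :
    ∃ c : ℕ → ℤ,
      (∀ q : ℕ, IsPrimePow q → q ≡ 1 [MOD 3] →
        (IsCubicCyclotomicInt q (c q) ∧
          ∀ c' : ℤ, IsCubicCyclotomicInt q c' → c' = c q) ∧
        q + 1 ≡ 2 [MOD 3] ∧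
        (∀ (F : Type*) [Field F] [Fintype F] [DecidableEq F], Fintype.card F = q →
          ∀ χ : MulChar F ℂ, orderOf χ = 3 → ∀ ω : ℂ, IsPrimitiveRoot ω 3 →
            IsOverThirdRoots (paleyWeighing χ + ω • (1 : Matrix (Unit ⊕ F) (Unit ⊕ F) ℂ)) ∧
            ‖(paleyWeighing χ + ω • (1 : Matrix (Unit ⊕ F) (Unit ⊕ F) ℂ)).det‖ =
              paleyDetValue q (c q)) ∧
        (∃ M : Matrix (Fin (q + 1)) (Fin (q + 1)) ℂ,
          IsOverThirdRoots M ∧ ‖M.det‖ = paleyDetValue q (c q))) ∧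
      Tendsto (fun q : ℕ => paleyDetValue q (c q) / barbaBound (q + 1))
        (atTop ⊓ 𝓟 {q : ℕ | IsPrimePow q ∧ q ≡ 1 [MOD 3]}) (𝓝 (1 / √2)) := by
  classical
  have hex : ∀ q : ℕ, ∃ c : ℤ, IsPrimePow q ∧ q ≡ 1 [MOD 3] → IsCubicCyclotomicInt q c := by
    intro q
    by_cases h : IsPrimePow q ∧ q ≡ 1 [MOD 3]
    · obtain ⟨c, hc⟩ := exists_isCubicCyclotomicInt h.1 h.2
      exact ⟨c, fun _ => hc⟩
    · exact ⟨0, fun h' => absurd h' h⟩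
  choose c hc using hex
  refine ⟨c, fun q hq hq3 => ⟨⟨hc q ⟨hq, hq3⟩, fun c' hc' => (hc q ⟨hq, hq3⟩).unique hq hq3 hc'⟩,
    hq3.add_right 1, ?_, ?_⟩, ?_⟩
  · rintro F _ _ _ rfl χ hχ ω hω
    exact ⟨isOverThirdRoots_paleyWeighing_add hχ hω.pow_eq_one,
      norm_det_eq_paleyDetValue (hc _ ⟨hq, hq3⟩) hχ hω⟩
  · obtain ⟨F, _, _, χ, rfl, hχ⟩ := exists_field_and_cubic_mulChar hq hq3
    have hω := Complex.isPrimitiveRoot_exp 3 (by norm_num)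
    set ω : ℂ := Complex.exp (2 * Real.pi * Complex.I / (3 : ℕ))
    let e : Fin (Fintype.card F + 1) ≃ Unit ⊕ F :=
      (Fintype.equivFinOfCardEq (by simp [add_comm])).symm
    refine ⟨(paleyWeighing χ + ω • (1 : Matrix (Unit ⊕ F) (Unit ⊕ F) ℂ)).submatrix e e,
      fun i j => isOverThirdRoots_paleyWeighing_add hχ hω.pow_eq_one (e i) (e j), ?_⟩
    rw [Matrix.det_submatrix_equiv_self]
    exact norm_det_eq_paleyDetValue (hc _ ⟨hq, hq3⟩) hχ hω
  · exact tendsto_paleyDetValue_div_barbaBound fun q hq => abs_cubicCyclotomicInt_le (hc q hq)
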